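/- All graphs are finite, simple and undirected. A total-colouring of a graph $G$ assigns a colour to every vertex and every edge of $G$ (no properness is required). A path in a total-coloured graph is total-rainbow if all its edges and all its inner vertices have pairwise distinct colours. For a connected graph $G$, the total-rainbow connection number $trc(G)$ is the minimum number of colours in a total-colouring of $G$ for which every two distinct vertices of $G$ are connected by a total-rainbow path. A graph is $2$-connected if it has at least three vertices, is connected, and remains connected after the deletion of any one vertex. If $G$ is a $2$-connected graph of order $n$ with diameter $2$, then $trc(G)\leq n-1$. -/

import Mathlib

namespace TotalRainbow

variable {V : Type*} {C : Type*}

/-- A graph is 2-connected if it has more than two vertices, is connected, and remains connected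
after deletion of any single vertex. -/
def IsTwoConnected [Fintype V] (G : SimpleGraph V) : Prop :=
  2 < Fintype.card V ∧ G.Connected ∧ ∀ v : V, (G.induce {v}ᶜ).Connected

/-- The inner vertices of a walk: all vertices of its vertex sequence except the first and the
last one. -/
def innerVertices {G : SimpleGraph V} {u v : V} (p : G.Walk u v) : List V :=
  p.support.tail.dropLast

/-- A total-rainbow path for a colouring `cV` of the vertices and `cE` of the edges: the edges and
the inner vertices of the path all have pairwise distinct colours. Vertices and edges are coloured
from the same set `C`; only the values of `cE` on the edges of the graph matter. -/
def IsTotalRainbowPath (cV : V → C) (cE : Sym2 V → C) {G : SimpleGraph V} {u v : V}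
    (p : G.Walk u v) : Prop :=
  p.IsPath ∧ (p.edges.map cE ++ (innerVertices p).map cV).Nodup

/-- `G` is total-rainbow connected with respect to the total-colouring `(cV, cE)`. -/
def IsTotalRainbowConnected (G : SimpleGraph V) (cV : V → C) (cE : Sym2 V → C) : Prop :=
  ∀ u v : V, u ≠ v → ∃ p : G.Walk u v, IsTotalRainbowPath cV cE p

/-- `G` can be made total-rainbow connected with (at most) `k` colours. -/
def IsTotalRainbowColorable (G : SimpleGraph V) (k : ℕ) : Prop :=
  ∃ (cV : V → Fin k) (cE : Sym2 V → Fin k), IsTotalRainbowConnected G cV cE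

/-- The total-rainbow connection number: the least number of colours making `G` total-rainbow
connected (and `⊤` when there is no such number, so that an upper bound is never vacuous). -/
noncomputable def trc (G : SimpleGraph V) : ℕ∞ :=
  ⨅ k ∈ {k : ℕ | IsTotalRainbowColorable G k}, (k : ℕ∞)

end TotalRainbow

namespace TotalRainbow

variable {V : Type*} {C : Type*}

/-! Label the vertices by an abelian group, colour an edge by the sum of its end labels and a vertex
by twice its label. By cancellation, a path `u c v` is total-rainbow as soon as the three labels
differ. With diameter 2, injective labels would give `n` colours. To save one, use only `n - 2`
labels, in `ZMod (n - 2)`, plus an extra colour `none`, which repairs the two forced repetitions. If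
some `w` is universal, all nonadjacent pairs are joined through `w`; giving every vertex the colour
`none` makes the label of `w` irrelevant, and the other repetition is put on an edge avoiding `w`,
whose ends need no path through `w`. Otherwise two nonadjacent pairs share labels, and one edge on a
two-edge path joining each pair is recoloured `none`. -/

theorem trc_le_of_card_eq [Fintype C] {G : SimpleGraph V} {k : ℕ} (hk : Fintype.card C = k)
    {cV : V → C} {cE : Sym2 V → C} (h : IsTotalRainbowConnected G cV cE) : trc G ≤ k := by
  let e : C ≃ Fin k := Fintype.equivFinOfCardEq hk
  refine iInf₂_le k ⟨e ∘ cV, e ∘ cE, fun u v huv => ?_⟩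
  obtain ⟨p, hp, hnd⟩ := h u v huv
  refine ⟨p, hp, ?_⟩
  have := hnd.map e.injective
  simpa only [List.map_append, List.map_map] using this

theorem exists_totalRainbowPath_of_adj {G : SimpleGraph V} {u v : V} (h : G.Adj u v)
    (cV : V → C) (cE : Sym2 V → C) : ∃ p : G.Walk u v, IsTotalRainbowPath cV cE p :=
  ⟨.cons h .nil, by simp [h.ne], by simp [innerVertices]⟩

theorem exists_totalRainbowPath_of_adj_adj {G : SimpleGraph V} {u w v : V} (huw : G.Adj u w)
    (hwv : G.Adj w v) (huv : u ≠ v) {cV : V → C} {cE : Sym2 V → C}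
    (h₁ : cE s(u, w) ≠ cE s(w, v)) (h₂ : cE s(u, w) ≠ cV w) (h₃ : cE s(w, v) ≠ cV w) :
    ∃ p : G.Walk u v, IsTotalRainbowPath cV cE p :=
  ⟨.cons huw (.cons hwv .nil), by simp [huw.ne, hwv.ne, huv],
    by simp [innerVertices, h₁, h₂, h₃]⟩

/-- The edge colour `l u + l v` induced by a labelling `l` of the vertices. -/
def edgeSum {A : Type*} [AddCommMonoid A] (l : V → A) : Sym2 V → A :=
  Sym2.lift ⟨fun a b => l a + l b, fun _ _ => add_comm _ _⟩

@[simp]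
theorem edgeSum_mk {A : Type*} [AddCommMonoid A] (l : V → A) (a b : V) :
    edgeSum l s(a, b) = l a + l b := rfl

/-- A labelling by two fewer labels than vertices, in which `y` repeats the label of `x` and `z`
repeats the label of `t`, and there are no other repetitions outside `{y, z}`. -/
theorem exists_label_merging [Fintype V] {A : Type*} [Fintype A]
    (hA : Fintype.card A + 2 = Fintype.card V) {x y z t : V} (hyz : y ≠ z)
    (hxy : x ≠ y) (hxz : x ≠ z) (hty : t ≠ y) (htz : t ≠ z) :
    ∃ l : V → A, l y = l x ∧ l z = l t ∧
      ∀ u v, u ≠ y → u ≠ z → v ≠ y → v ≠ z → l u = l v → u = v := by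
  classical
  have hcard : Fintype.card {v : V // v ∈ ({y, z} : Finset V)ᶜ} = Fintype.card A := by
    rw [Fintype.card_coe, Finset.card_compl, Finset.card_pair hyz]
    omega
  let φ := Fintype.equivOfCardEq hcard
  have hmem : ∀ v, v ≠ y → v ≠ z → v ∈ ({y, z} : Finset V)ᶜ := by simp +contextual
  let e : V → A := fun v =>
    if h : v ∈ ({y, z} : Finset V)ᶜ then φ ⟨v, h⟩ else φ ⟨x, hmem x hxy hxz⟩
  have he : ∀ u v, u ≠ y → u ≠ z → v ≠ y → v ≠ z → e u = e v → u = v := by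
    intro u v hu hu' hv hv' h
    simpa [e, hu, hu', hv, hv'] using h
  refine ⟨fun v => if v = y then e x else if v = z then e t else e v, ?_, ?_, ?_⟩
  · simp [hxy, hxz]
  · simp [hyz.symm, hty, htz]
  · intro u v hu hu' hv hv' h
    simp only [hu, hu', hv, hv', if_false] at h
    exact he u v hu hu' hv hv' h

/-- In a graph of diameter two, nonadjacent vertices have a common neighbour. -/
theorem exists_common_adj {G : SimpleGraph V} (hdiam : G.diam = 2) {u v : V} (huv : u ≠ v)
    (hnadj : ¬ G.Adj u v) : ∃ w, G.Adj u w ∧ G.Adj w v := by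
  have htop : G.ediam ≠ ⊤ := by
    intro h
    simp [SimpleGraph.diam, h] at hdiam
  have hdist : G.dist u v ≤ 2 := hdiam ▸ SimpleGraph.dist_le_diam htop
  have hconn : G.Connected := by
    have : Nonempty V := ⟨u⟩
    exact SimpleGraph.connected_of_ediam_ne_top htop
  obtain ⟨p, hp⟩ := hconn.exists_walk_length_eq_dist u v
  match p, hp with
  | .nil, _ => exact absurd rfl huv
  | .cons h .nil, _ => exact absurd h hnadj
  | .cons h (.cons h' .nil), _ => exact ⟨_, h, h'⟩
  | .cons _ (.cons _ (.cons _ _)), hp =>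
    simp only [SimpleGraph.Walk.length_cons] at hp
    omega

/-- If only the nonadjacent pairs `{x, y}` and `{w, z}` repeat a label, then colouring by sums of
labels, with the edges `xw` and `zw'` recoloured by an extra colour, makes the graph total-rainbow
connected. -/
theorem isTotalRainbowConnected_of_label [DecidableEq V] {A : Type*} [AddCommGroup A]
    {G : SimpleGraph V} (hdist : ∀ u v, u ≠ v → ¬ G.Adj u v → ∃ c, G.Adj u c ∧ G.Adj c v)
    {x y w z w' : V} (l : V → A)
    (hl : ∀ u v, l u = l v → u = v ∨ s(u, v) = s(x, y) ∨ s(u, v) = s(w, z))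
    (hxy : ¬ G.Adj x y) (hxw : G.Adj x w) (hwy : G.Adj w y) (hwz : ¬ G.Adj w z)
    (hww' : G.Adj w w') (hwz' : G.Adj w' z) (hxw' : w' ≠ x) (hne : x ≠ y)
    (hne' : w ≠ z) :
    IsTotalRainbowConnected G (fun v => some (l v + l v))
      (fun e => if e = s(x, w) ∨ e = s(z, w') then none else some (edgeSum l e)) := by
  have hlab : ∀ {u v}, G.Adj u v → l u ≠ l v := by
    intro u v huv h
    rcases hl u v h with h | h | h
    · exact huv.ne h
    · exact hxy (by rwa [← SimpleGraph.mem_edgeSet, ← h])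
    · exact hwz (by rwa [← SimpleGraph.mem_edgeSet, ← h])
  have hxz : x ≠ z := by rintro rfl; exact hwz hxw.symm
  have hyz : y ≠ z := by rintro rfl; exact hwz hwy
  intro u v huv
  by_cases hadj : G.Adj u v
  · exact exists_totalRainbowPath_of_adj hadj _ _
  have key : ∀ {u c v}, G.Adj u c → G.Adj c v → u ≠ v →
      (l u = l v → s(u, c) = s(x, w) ∨ s(u, c) = s(z, w') ∨
        s(c, v) = s(x, w) ∨ s(c, v) = s(z, w')) →
      ∃ p : G.Walk u v, IsTotalRainbowPath (fun v => some (l v + l v))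
      (fun e => if e = s(x, w) ∨ e = s(z, w') then none else some (edgeSum l e)) p := by
    intro u c v huc hcv huv h
    have h₁ := hlab huc
    have h₂ := hlab hcv
    refine exists_totalRainbowPath_of_adj_adj huc hcv huv ?_ ?_ ?_
    · have := huc.ne
      have := hcv.ne
      have := hxw.ne
      have := hww'.ne
      have := hwz'.ne
      by_cases a : s(u, c) = s(x, w) ∨ s(u, c) = s(z, w') <;>
      by_cases b : s(c, v) = s(x, w) ∨ s(c, v) = s(z, w')
      -- The recoloured edges `xw` and `zw'` are disjoint, so no two-edge path contains both.
      · exfalso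
        simp only [Sym2.eq_iff] at a b
        grind
      · simp only [if_pos a, if_neg b, ne_eq, reduceCtorEq, not_false_eq_true]
      · simp only [if_neg a, if_pos b, ne_eq, reduceCtorEq, not_false_eq_true]
      · simp only [a, b, if_false, edgeSum_mk, ne_eq, Option.some.injEq]
        rw [add_comm (l c), add_left_inj]
        tauto
    · split_ifs <;> simp [h₁]
    · split_ifs <;> simp [h₂.symm]
  by_cases hluv : l u = l v
  · rcases hl u v hluv with h | h | h
    · exact absurd h huv
    · rcases Sym2.eq_iff.1 h with ⟨rfl, rfl⟩ | ⟨rfl, rfl⟩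
      · exact key hxw hwy huv fun _ => by simp
      · exact key hwy.symm hxw.symm huv fun _ => by simp [Sym2.eq_swap]
    · rcases Sym2.eq_iff.1 h with ⟨rfl, rfl⟩ | ⟨rfl, rfl⟩
      · exact key hww' hwz' huv fun _ => by simp [Sym2.eq_swap]
      · exact key hwz'.symm hww'.symm huv fun _ => by simp
  · obtain ⟨c, huc, hcv⟩ := hdist u v huv hadj
    exact key huc hcv huv fun h => absurd h hluv

/-- If `w` is adjacent to all other vertices and only the edge `xy` repeats a label outside `w`,
then colouring the edges by sums of labels and all vertices by an extra colour makes the graph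
total-rainbow connected. -/
theorem isTotalRainbowConnected_of_universal {A : Type*} [AddCommGroup A]
    {G : SimpleGraph V} {x y w : V} (hw : ∀ v, v ≠ w → G.Adj v w) (hxy : G.Adj x y) (l : V → A)
    (hl : ∀ u v, u ≠ w → v ≠ w → l u = l v → u = v ∨ s(u, v) = s(x, y)) :
    IsTotalRainbowConnected G (fun _ => none) (fun e => some (edgeSum l e)) := by
  intro u v huv
  by_cases hadj : G.Adj u v
  · exact exists_totalRainbowPath_of_adj hadj _ _
  have hu : u ≠ w := by rintro rfl; exact hadj (hw v huv.symm).symm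
  have hv : v ≠ w := by rintro rfl; exact hadj (hw u huv)
  refine exists_totalRainbowPath_of_adj_adj (hw u hu) (hw v hv).symm huv ?_ (by simp) (by simp)
  simp only [edgeSum_mk, ne_eq, Option.some.injEq]
  rw [add_comm (l w), add_left_inj]
  intro h
  rcases hl u v hu hv h with h | h
  · exact huv h
  · exact hadj (by rwa [← SimpleGraph.mem_edgeSet, h])

/-- In a 2-connected graph every vertex is avoided by some edge. -/
theorem IsTwoConnected.exists_adj_avoiding [Fintype V] {G : SimpleGraph V}
    (h : IsTwoConnected G) (w : V) : ∃ x y, x ≠ w ∧ y ≠ w ∧ G.Adj x y := by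
  classical
  obtain ⟨a, b, ha, hb, hab⟩ : ∃ a b, a ≠ w ∧ b ≠ w ∧ a ≠ b := by
    obtain ⟨a, b, c, hab, hac, hbc⟩ := Fintype.two_lt_card_iff.1 h.1
    by_cases ha : a = w
    · exact ⟨b, c, by grind, by grind, hbc⟩
    by_cases hb : b = w
    · exact ⟨a, c, ha, by grind, hac⟩
    · exact ⟨a, b, ha, hb, hab⟩
  have hab' : (⟨a, ha⟩ : ({w}ᶜ : Set V)) ≠ ⟨b, hb⟩ := fun h => hab (congrArg Subtype.val h)
  obtain ⟨p⟩ := (h.2.2 w).preconnected ⟨a, ha⟩ ⟨b, hb⟩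
  match p with
  | .nil => exact absurd rfl hab
  | .cons (v := v) hadj _ => exact ⟨a, v, ha, v.2, hadj⟩

end TotalRainbow

open TotalRainbow in
theorem corollary4p2 {V : Type*} [Fintype V] (G : SimpleGraph V) (n : ℕ)
    (hn : Fintype.card V = n) (h2 : TotalRainbow.IsTwoConnected G) (hdiam : G.diam = 2) :
    TotalRainbow.trc G ≤ ((n - 1 : ℕ) : ℕ∞) := by
  classical
  have hn2 : 2 < n := hn ▸ h2.1
  have : NeZero (n - 2) := ⟨by omega⟩
  have hA : Fintype.card (ZMod (n - 2)) + 2 = Fintype.card V := by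
    rw [ZMod.card, hn]; omega
  have hC : Fintype.card (Option (ZMod (n - 2))) = n - 1 := by
    rw [Fintype.card_option, ZMod.card]; omega
  have hdist : ∀ u v, u ≠ v → ¬ G.Adj u v → ∃ c, G.Adj u c ∧ G.Adj c v :=
    fun u v => exists_common_adj hdiam
  by_cases huniv : ∃ w, ∀ v, v ≠ w → G.Adj v w
  · obtain ⟨w, hw⟩ := huniv
    obtain ⟨x, y, hxw, hyw, hxy⟩ := h2.exists_adj_avoiding w
    -- The label of `w` cancels on every path through `w`, so it may repeat that of `x`.
    obtain ⟨l, hly, -, hl⟩ := exists_label_merging hA hyw hxy.ne hxw hxy.ne hxw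
    refine trc_le_of_card_eq hC (isTotalRainbowConnected_of_universal hw hxy l ?_)
    intro u v hu hv h
    rw [Sym2.eq_iff]
    have := hxy.ne
    clear hdist
    by_cases u = y <;> by_cases v = y <;> grind
  · push Not at huniv
    obtain ⟨x₀⟩ := h2.2.1.nonempty
    obtain ⟨y₀, hne₀, hxy₀⟩ := huniv x₀
    obtain ⟨w, hyw₀, hwx₀⟩ := hdist y₀ x₀ hne₀ hxy₀
    obtain ⟨z, hzw, hzw'⟩ := huniv w
    obtain ⟨w', hzw₁, hww'⟩ := hdist z w hzw hzw'
    -- `x₀` and `y₀` play symmetric roles and `w'` equals at most one of them; naming the other `x`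
    -- keeps `xw` and `zw'` disjoint.
    obtain ⟨x, y, hne, hxy, hxw, hyw, hxw'⟩ : ∃ x y, x ≠ y ∧ ¬ G.Adj x y ∧ G.Adj x w ∧
        G.Adj w y ∧ w' ≠ x := by
      by_cases h : w' = y₀
      · exact ⟨x₀, y₀, hne₀.symm, fun h => hxy₀ h.symm, hwx₀.symm, hyw₀.symm, h ▸ hne₀⟩
      · exact ⟨y₀, x₀, hne₀, hxy₀, hyw₀, hwx₀, h⟩
    have hwz : ¬ G.Adj w z := fun h => hzw' h.symm
    have hxz : x ≠ z := by rintro rfl; exact hwz hxw.symm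
    have hyz : y ≠ z := by rintro rfl; exact hwz hyw
    obtain ⟨l, hly, hlz, hl⟩ := exists_label_merging hA hyz hne hxz hyw.ne hzw.symm
    refine trc_le_of_card_eq hC (isTotalRainbowConnected_of_label hdist l ?_ hxy hxw hyw hwz
      hww'.symm hzw₁.symm hxw' hne hzw.symm)
    intro u v h
    simp only [Sym2.eq_iff]
    have := hxw.ne
    have := hyw.ne
    clear hdist
    by_cases u = y <;> by_cases v = y <;> by_cases u = z <;> by_cases v = z <;> grind
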